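/- For a real symmetric $n\times n$ matrix $M$, fix an orthonormal basis of eigenvectors $u_1,\dots,u_n$ whose eigenvalues are listed with multiplicity as $\lambda_1\ge\dots\ge\lambda_n$, and for $1\le p<n$ let $\Pi_p=\sum_{i\le p}u_iu_i^T$. Let $\|\cdot\|$ denote the spectral norm. For every $K\ge 0$ there are a constant $C$, an exponent $k\in\mathbb N$ and a sequence $\varepsilon_n\to 0$, all depending only on $K$, such that the following holds for all integers $1\le p<n$ and all $r$. Let $A$ be a deterministic real symmetric $n\times n$ matrix of rank $r$ with ordered eigenvalues $\lambda_i$ and corresponding orthonormal eigenvectors $u_i$, and put $\delta_p=\lambda_p-\lambda_{p+1}$. Assume that $\lambda_p\ne0$ and $\delta_p\ge 2.01\sqrt n$. Let $E$ be an $n\times n$ Wigner matrix with sub-Gaussian entries: a random real symmetric matrix whose entries $\xi$ on and above the diagonal are independent and identically distributed, with $\mathbb E\,\xi=0$, $\operatorname{Var}\xi=1$ and $\mathbb E\,e^{t\xi}\le e^{Kt^2/2}$ for all $t\in\mathbb R$. Put $\tilde A=A+E$, and let $\tilde\Pi_p$ be the corresponding projection for $\tilde A$. Then, with probability at least $1-\varepsilon_n$,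 $$\|\tilde\Pi_p-\Pi_p\|\le C(\log n)^k\left(\frac{\|E\|}{|\lambda_p|}+\frac{r^2}{\delta_p}\right),$$ for every choice of the ordered orthonormal eigenvectors of $\tilde A$ that define $\tilde\Pi_p$. -/

import Mathlib

open MeasureTheory ProbabilityTheory Filter Topology
open scoped NNReal Matrix Matrix.Norms.L2Operator

-- Throughout, the norm of a real square matrix is the spectral norm (the operator norm for the
-- Euclidean norm), through the scoped instance opened above.

/-- `ev` and `u` are eigenvalues and eigenvectors of the real symmetric matrix `M`: `u` is an
orthonormal basis of Euclidean space, `u i` is an eigenvector for `ev i`, and the eigenvalues are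
listed with multiplicity in decreasing order (indices start at `0`). -/
structure IsSpectralDecomposition {n : ℕ} (M : Matrix (Fin n) (Fin n) ℝ) (ev : Fin n → ℝ)
    (u : OrthonormalBasis (Fin n) ℝ (EuclideanSpace ℝ (Fin n))) : Prop where
  antitone : Antitone ev
  mulVec_eq : ∀ i, M *ᵥ (u i).ofLp = ev i • (u i).ofLp

/-- Every real symmetric matrix has such a spectral decomposition. -/
theorem exists_isSpectralDecomposition {n : ℕ} {M : Matrix (Fin n) (Fin n) ℝ} (hM : M.IsSymm) :
    ∃ ev u, IsSpectralDecomposition M ev u := by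
  have hH : M.IsHermitian := by
    rw [Matrix.IsHermitian, Matrix.conjTranspose_eq_transpose_of_trivial]; exact hM
  let e : Fin (Fintype.card (Fin n)) ≃ Fin n :=
    Fintype.equivOfCardEq (Fintype.card_fin (Fintype.card (Fin n)))
  let c : Fin (Fintype.card (Fin n)) ≃ Fin n := finCongr (Fintype.card_fin n)
  refine ⟨fun i => hH.eigenvalues₀ (c.symm i), hH.eigenvectorBasis.reindex (e.symm.trans c),
    ?_, ?_⟩
  · intro i j hij
    exact hH.eigenvalues₀_antitone hij
  · intro i
    have h := hH.mulVec_eigenvectorBasis (e (c.symm i))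
    have h2 : hH.eigenvalues (e (c.symm i)) = hH.eigenvalues₀ (c.symm i) := by
      simp [Matrix.IsHermitian.eigenvalues, e]
    rw [h2] at h
    simpa using h

/-- `Π_p = ∑_{i ≤ p} u_i u_iᵀ`, built from the first `p` vectors of the orthonormal basis `u`. -/
noncomputable def leadingProj {n : ℕ}
    (u : OrthonormalBasis (Fin n) ℝ (EuclideanSpace ℝ (Fin n))) (p : ℕ) :
    Matrix (Fin n) (Fin n) ℝ :=
  ∑ i : Fin n with i.val < p, Matrix.vecMulVec (u i).ofLp (u i).ofLp

/-- `E` is a Wigner matrix with sub-Gaussian entries: a random real symmetric matrix whose entries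
on and above the diagonal are independent and identically distributed, with mean `0`, variance `1`,
and sub-Gaussian with variance proxy `K`, that is, `𝔼 exp (t X) ≤ exp (K t² / 2)` for all real
`t`. -/
structure IsWigner {Ω : Type*} [MeasurableSpace Ω] {n : ℕ}
    (E : Ω → Matrix (Fin n) (Fin n) ℝ) (K : ℝ≥0) (μ : Measure Ω) : Prop where
  measurable : ∀ i j, Measurable fun ω => E ω i j
  symm : ∀ ω, (E ω).IsSymm
  indep : iIndepFun (fun (q : {q : Fin n × Fin n // q.1 ≤ q.2}) ω => E ω q.1.1 q.1.2) μ
  identDistrib : ∀ i j k l, i ≤ j → k ≤ l →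
    IdentDistrib (fun ω => E ω i j) (fun ω => E ω k l) μ μ
  mean : ∀ i j, i ≤ j → ∫ ω, E ω i j ∂μ = 0
  variance : ∀ i j, i ≤ j → ProbabilityTheory.variance (fun ω => E ω i j) μ = 1
  subgaussian : ∀ i j, i ≤ j → HasSubgaussianMGF (fun ω => E ω i j) K μ

/-!
Write `P`, `P'` for the two spectral projections and `N` for the projection onto the range of `A`.
Everything rests on a deterministic bound whose inputs are `‖E‖` and the compression `N E N`.
Let `λ_p > 0`, let `‖E‖` be at most `λ_p / 2` and `y = ‖N E N‖` at most `δ_p / 2`.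

* The range of `P` lies in that of `N`, so by Courant–Fischer the leading eigenvalues of `A + E` are
  at least `λ_p - y`: they stay away from `λ_{p+1}` although `‖E‖` itself may be larger than `δ_p`
  (`sub_le_eigenvalue_of_inner_le`).
* Split `1 - P = (1 - N) + (N - P)`. The Sylvester equation behind the Davis–Kahan theorem
  (`sub_mul_norm_specProj_mul_le`) bounds `(1 - N) P'` by `2 ‖E‖ / λ_p`, as `A` vanishes on the
  kernel part, and then `(N - P) P'` by `2 (y + ‖E‖ ‖(1 - N) P'‖) / δ_p`
  (`norm_specProj_sub_le_of_gap`).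
* As `P` and `P'` have equal rank, `‖P' - P‖ ≤ 4 ‖(1 - P) P'‖` (`norm_specProj_sub_le`).

The case `λ_p < 0` follows by passing to `-A`. Since `y ≤ r² max |u_iᵀ E u_j|`, it remains to show
that, up to logarithms, `‖E‖ = O(√n) = O(δ_p)` and `u_iᵀ E u_j = O(1)` with high probability. Both
come from the sub-Gaussian tail of `aᵀ E b` for fixed `a` and `b`, by a union bound over a grid
(`IsWigner.measure_norm_ge_le`) and over the pairs of basis vectors
(`IsWigner.measure_exists_basis_ge_le`). Because logarithms are allowed in the conclusion, the
sharp value `2√n` of the norm of a Wigner matrix plays no role. When the smallness conditions fail,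
the right-hand side exceeds the trivial bound `2`.
-/

/-! ### Operators diagonal in an orthonormal basis -/

section Diagonal

open InnerProductSpace
open scoped RealInnerProductSpace

variable {ι V : Type*} [Fintype ι] [NormedAddCommGroup V] [InnerProductSpace ℝ V]

/-- The operator `∑ i, f i • u i (u i)ᵀ`, which is diagonal in the orthonormal basis `u` with
eigenvalues `f`. Spectral projections are the case where `f` is an indicator function. -/
noncomputable def diagOp (u : OrthonormalBasis ι ℝ V) (f : ι → ℝ) : V →L[ℝ] V :=
  ∑ i, f i • rankOne ℝ (u i) (u i)

variable (u : OrthonormalBasis ι ℝ V) (f g : ι → ℝ)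

theorem diagOp_apply_basis [DecidableEq ι] (j : ι) : diagOp u f (u j) = f j • u j := by
  simp [diagOp, orthonormal_iff_ite.mp u.orthonormal]

theorem OrthonormalBasis.clm_ext {S T : V →L[ℝ] V} (h : ∀ i, S (u i) = T (u i)) : S = T := by
  have : (S : V →ₗ[ℝ] V) = T := u.toBasis.ext fun i => by simpa using h i
  ext x
  exact congrArg (fun L : V →ₗ[ℝ] V => L x) this

theorem OrthonormalBasis.ext_inner {x y : V} (h : ∀ i, ⟪u i, x⟫ = ⟪u i, y⟫) : x = y := by
  rw [← u.sum_repr' x, ← u.sum_repr' y]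
  exact Finset.sum_congr rfl fun i _ => by rw [h]

theorem eq_diagOp {T : V →L[ℝ] V} (h : ∀ i, T (u i) = f i • u i) : T = diagOp u f := by
  classical
  exact u.clm_ext fun i => by rw [h, diagOp_apply_basis]

theorem diagOp_mul : diagOp u f * diagOp u g = diagOp u (f * g) := by
  classical
  refine eq_diagOp u _ fun i => ?_
  simp [diagOp_apply_basis, smul_smul, mul_comm]

theorem diagOp_one : diagOp u 1 = 1 := by
  symm
  exact eq_diagOp u _ fun i => by simp

theorem diagOp_sub : diagOp u (f - g) = diagOp u f - diagOp u g := by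
  simp [diagOp, sub_smul, Finset.sum_sub_distrib]

theorem diagOp_neg : diagOp u (-f) = -diagOp u f := by
  simp [diagOp]

theorem diagOp_smul (c : ℝ) : diagOp u (c • f) = c • diagOp u f := by
  simp [diagOp, smul_smul, Finset.smul_sum]

theorem inner_diagOp_left (x y : V) : ⟪diagOp u f x, y⟫ = ⟪x, diagOp u f y⟫ := by
  simp only [diagOp, sum_apply, sum_inner, inner_sum]
  refine Finset.sum_congr rfl fun i _ => ?_
  simp only [smul_apply, rankOne_apply, inner_smul_left, inner_smul_right,
    conj_trivial]
  rw [real_inner_comm x (u i)]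
  ring

theorem inner_basis_diagOp (i : ι) (x : V) : ⟪u i, diagOp u f x⟫ = f i * ⟪u i, x⟫ := by
  classical
  rw [← inner_diagOp_left, diagOp_apply_basis, inner_smul_left, conj_trivial]

theorem inner_self_diagOp (x : V) : ⟪x, diagOp u f x⟫ = ∑ i, f i * ⟪u i, x⟫ ^ 2 := by
  rw [← u.sum_inner_mul_inner]
  refine Finset.sum_congr rfl fun i _ => ?_
  rw [inner_basis_diagOp, real_inner_comm]
  ring

theorem norm_diagOp_le {c : ℝ} (hc : 0 ≤ c) (h : ∀ i, |f i| ≤ c) : ‖diagOp u f‖ ≤ c := by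
  refine ContinuousLinearMap.opNorm_le_bound _ hc fun x => ?_
  refine le_of_sq_le_sq ?_ (by positivity)
  rw [← u.sum_sq_norm_inner_right, mul_pow, ← u.sum_sq_norm_inner_right x, Finset.mul_sum]
  refine Finset.sum_le_sum fun i _ => ?_
  rw [inner_basis_diagOp, norm_mul, mul_pow]
  have := h i
  rw [Real.norm_eq_abs (f i)]
  gcongr

/-- The spectral projection onto the span of the basis vectors indexed by `S`. -/
noncomputable def specProj (S : Set ι) : V →L[ℝ] V := diagOp u (S.indicator 1)

variable (S : Set ι)

theorem norm_specProj_le : ‖specProj u S‖ ≤ 1 := by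
  classical
  refine norm_diagOp_le u _ zero_le_one fun i => ?_
  by_cases hi : i ∈ S <;> simp [hi]

theorem specProj_compl : specProj u Sᶜ = 1 - specProj u S := by
  rw [specProj, specProj, ← diagOp_one u, ← diagOp_sub, Set.indicator_compl]

theorem norm_one_sub_specProj_le : ‖1 - specProj u S‖ ≤ 1 := by
  rw [← specProj_compl]; exact norm_specProj_le u Sᶜ

theorem specProj_mul_specProj (T : Set ι) : specProj u S * specProj u T = specProj u (S ∩ T) := by
  rw [specProj, specProj, specProj, diagOp_mul, Set.inter_indicator_one]

theorem specProj_apply_eq_self {x : V} (h : ∀ i ∉ S, ⟪u i, x⟫ = 0) : specProj u S x = x := by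
  classical
  refine u.ext_inner fun i => ?_
  rw [specProj, inner_basis_diagOp]
  by_cases hi : i ∈ S <;> simp [hi, h i]

/-- For symmetric `T` and `U`, the products `T * U` and `U * T` are adjoint to each other. -/
theorem norm_mul_comm_of_symm [CompleteSpace V] {T U : V →L[ℝ] V}
    (hT : ∀ x y, ⟪T x, y⟫ = ⟪x, T y⟫) (hU : ∀ x y, ⟪U x, y⟫ = ⟪x, U y⟫) : ‖T * U‖ = ‖U * T‖ := by
  have : ContinuousLinearMap.adjoint (T * U) = U * T := by
    symm
    rw [ContinuousLinearMap.eq_adjoint_iff]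
    intro x y
    simp [hT, hU]
  rw [← this, LinearIsometryEquiv.norm_map]

theorem inner_specProj_left (x y : V) : ⟪specProj u S x, y⟫ = ⟪x, specProj u S y⟫ :=
  inner_diagOp_left u _ x y

theorem inner_one_sub_specProj_left (x y : V) :
    ⟪(1 - specProj u S) x, y⟫ = ⟪x, (1 - specProj u S) y⟫ := by
  rw [← specProj_compl, inner_specProj_left]

/-! ### Comparison of projections of equal rank -/

/-- For two spectral projections `P`, `P'` of the same rank, it is enough to control the part of
`P'` that leaves the range of `P`: if `P` is almost isometric on the range of `P'`, it maps it
onto the range of `P`, so each vector of the range of `P` is close to the range of `P'`. -/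
theorem norm_specProj_sub_le (u' : OrthonormalBasis ι ℝ V) :
    ‖specProj u' S - specProj u S‖ ≤ 4 * ‖(1 - specProj u S) * specProj u' S‖ := by
  classical
  have : FiniteDimensional ℝ V := u.toBasis.finiteDimensional_of_finite
  set P := specProj u S with hP
  set P' := specProj u' S with hP'
  set s := ‖(1 - P) * P'‖ with hs
  have hs0 : 0 ≤ s := norm_nonneg _
  by_cases h2 : 1 / 2 < s
  · calc ‖P' - P‖ ≤ ‖P'‖ + ‖P‖ := norm_sub_le _ _
      _ ≤ 1 + 1 := add_le_add (norm_specProj_le u' S) (norm_specProj_le u S)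
      _ ≤ 4 * s := by linarith
  push Not at h2
  -- The compression of `P` to the range of `P'`, in coordinates.
  let emb : (S → ℝ) →ₗ[ℝ] V := Fintype.linearCombination ℝ (fun i : S => u' i)
  let L : (S → ℝ) →ₗ[ℝ] (S → ℝ) := LinearMap.pi fun j => (innerₗ V (u j)) ∘ₗ emb
  have hemb : ∀ a, P' (emb a) = emb a := fun a => by
    refine specProj_apply_eq_self u' S fun i hi => ?_
    simp only [emb, Fintype.linearCombination_apply, inner_sum, inner_smul_right,
      orthonormal_iff_ite.mp u'.orthonormal]
    refine Finset.sum_eq_zero fun j _ => ?_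
    have : i ≠ j := fun h => hi (h ▸ j.2)
    simp [this]
  have hdist : ∀ a, ‖(1 - P) (emb a)‖ ≤ s * ‖emb a‖ := fun a => by
    have := ((1 - P) * P').le_opNorm (emb a)
    rwa [mul_apply_eq_comp, hemb] at this
  have hinj : Function.Injective L := by
    rw [injective_iff_map_eq_zero]
    intro a ha
    have h0 : P (emb a) = 0 := by
      refine u.ext_inner fun i => ?_
      rw [hP, specProj, inner_basis_diagOp]
      by_cases hi : i ∈ S
      · have : ⟪u i, emb a⟫ = 0 := congrFun ha ⟨i, hi⟩
        simp [this]
      · simp [hi]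
    have h1 := hdist a
    rw [sub_apply, h0, one_apply_eq_self, sub_zero] at h1
    have h3 : emb a = 0 := by
      rw [← norm_eq_zero]
      nlinarith [norm_nonneg (emb a)]
    ext j
    have h4 : ⟪u' j, emb a⟫ = a j := by
      simp [emb, Fintype.linearCombination_apply, inner_sum, inner_smul_right,
        orthonormal_iff_ite.mp u'.orthonormal, Subtype.coe_inj]
    rw [← h4, h3, inner_zero_right, Pi.zero_apply]
  have hsurj := LinearMap.injective_iff_surjective.mp hinj
  have hback : ‖(1 - P') * P‖ ≤ 2 * s := by
    refine ContinuousLinearMap.opNorm_le_bound _ (by positivity) fun x => ?_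
    obtain ⟨a, ha⟩ := hsurj fun j => ⟪u j, x⟫
    have h0 : P (emb a) = P x := by
      refine u.ext_inner fun i => ?_
      rw [hP, specProj, inner_basis_diagOp, inner_basis_diagOp]
      by_cases hi : i ∈ S
      · have : ⟪u i, emb a⟫ = ⟪u i, x⟫ := congrFun ha ⟨i, hi⟩
        rw [this]
      · simp [hi]
    have h1 : ((1 - P') * P) x = -(1 - P') ((1 - P) (emb a)) := by
      simp only [mul_apply_eq_comp, sub_apply,
        one_apply_eq_self, map_sub, hemb, h0]
      abel
    have h3 : ‖P x‖ ≤ ‖x‖ := by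
      simpa using (specProj u S).le_of_opNorm_le (norm_specProj_le u S) x
    have h4 : ‖(1 - P') ((1 - P) (emb a))‖ ≤ ‖(1 - P) (emb a)‖ := by
      simpa using (1 - P').le_of_opNorm_le (norm_one_sub_specProj_le u' S) ((1 - P) (emb a))
    have h5 : ‖emb a‖ ≤ ‖P x‖ + ‖(1 - P) (emb a)‖ := by
      have : emb a = P x + (1 - P) (emb a) := by simp [h0]
      conv_lhs => rw [this]
      exact norm_add_le _ _
    have h6 := hdist a
    have h7 : s * ‖emb a‖ ≤ 1 / 2 * ‖emb a‖ := by gcongr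
    have h8 : s * ‖emb a‖ ≤ s * (2 * ‖x‖) := by gcongr; linarith
    rw [h1, norm_neg]
    linarith
  have hsplit : P' - P = (1 - P) * P' - P * (1 - P') := by noncomm_ring
  have hadj : ‖P * (1 - P')‖ = ‖(1 - P') * P‖ :=
    norm_mul_comm_of_symm (inner_specProj_left u S) (inner_one_sub_specProj_left u' S)
  calc ‖P' - P‖ ≤ ‖(1 - P) * P'‖ + ‖P * (1 - P')‖ := hsplit ▸ norm_sub_le _ _
    _ ≤ 4 * s := by rw [hadj]; linarith

/-! ### Perturbation of eigenvalues and of spectral projections -/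

section Perturbation

variable {u S} {u' : OrthonormalBasis ι ℝ V} {ev ev' : ι → ℝ} {E : V →L[ℝ] V} {a b y : ℝ}

/-- Courant–Fischer: if `E` lowers the quadratic form of `A` by at most `y` on the span of `u i`,
`i ∈ S`, then the leading `|S|` eigenvalues of `A + E` are at least `a - y`. -/
theorem sub_le_eigenvalue_of_inner_le (hE : diagOp u ev + E = diagOp u' ev')
    (ha : ∀ i ∈ S, a ≤ ev i) (hsep : ∀ i ∈ S, ∀ j ∉ S, ev' j ≤ ev' i)
    (hy : ∀ x, specProj u S x = x → -(y * ‖x‖ ^ 2) ≤ ⟪x, E x⟫) {i : ι} (hi : i ∈ S) :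
    a - y ≤ ev' i := by
  classical
  have : FiniteDimensional ℝ V := u.toBasis.finiteDimensional_of_finite
  obtain ⟨m, hm, hmin⟩ := (S.toFinite).exists_minimalFor ev' S ⟨i, hi⟩
  have hmin' : ∀ j ∈ S, ev' m ≤ ev' j := fun j hj =>
    (le_total (ev' m) (ev' j)).elim id (hmin hj)
  refine le_trans ?_ (hmin' i hi)
  -- A dimension count gives a nonzero vector in the span of `u j`, `j ∈ S`, and orthogonal to
  -- the `u' j`, `j ∈ S`, `j ≠ m`.
  let w : ι → V := fun j => if j ∈ S then u' j else u j
  let L : V →ₗ[ℝ] ({j // j ≠ m} → ℝ) := LinearMap.pi fun j => innerₗ V (w j)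
  have hker : L.ker ≠ ⊥ := by
    refine LinearMap.ker_ne_bot_of_finrank_lt ?_
    rw [Module.finrank_fintype_fun_eq_card, Module.finrank_eq_card_basis u.toBasis]
    exact Fintype.card_subtype_lt (x := m) (by simp)
  obtain ⟨x, hx, hx0⟩ := (Submodule.ne_bot_iff _).mp hker
  have hx1 : ∀ j, j ≠ m → ⟪w j, x⟫ = 0 := fun j hj => congrFun hx ⟨j, hj⟩
  have hxu : ∀ j ∉ S, ⟪u j, x⟫ = 0 := fun j hj => by
    have := hx1 j (fun h => hj (h ▸ hm))
    simpa [w, hj] using this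
  have hxu' : ∀ j ∈ S, j ≠ m → ⟪u' j, x⟫ = 0 := fun j hj hjm => by
    have := hx1 j hjm
    simpa [w, hj] using this
  have hlow : a * ‖x‖ ^ 2 ≤ ⟪x, diagOp u ev x⟫ := by
    rw [inner_self_diagOp, ← u.sum_sq_norm_inner_right, Finset.mul_sum]
    refine Finset.sum_le_sum fun j _ => ?_
    by_cases hj : j ∈ S
    · rw [Real.norm_eq_abs, sq_abs]
      exact mul_le_mul_of_nonneg_right (ha j hj) (sq_nonneg _)
    · simp [hxu j hj]
  have hupp : ⟪x, diagOp u' ev' x⟫ ≤ ev' m * ‖x‖ ^ 2 := by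
    rw [inner_self_diagOp, ← u'.sum_sq_norm_inner_right, Finset.mul_sum]
    refine Finset.sum_le_sum fun j _ => ?_
    rw [Real.norm_eq_abs, sq_abs]
    by_cases hj : j ∈ S
    · by_cases hjm : j = m
      · rw [hjm]
      · simp [hxu' j hj hjm]
    · exact mul_le_mul_of_nonneg_right (hsep m hm j hj) (sq_nonneg _)
  have hEx := hy x (specProj_apply_eq_self u S hxu)
  rw [← hE, add_apply, inner_add_right] at hupp
  have hpos : 0 < ‖x‖ ^ 2 := by positivity
  nlinarith

/-- Sylvester equation: if the spectrum of `T = diagOp u' ev'` on the range of `P' = specProj u' S`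
lies in `[a, ∞)` and that of `A = diagOp u ev` on the range of `P = specProj u R` lies in
`(-∞, b]`, then `(a - b) ‖P P'‖ ≤ ‖P (T - A) P'‖`. -/
theorem sub_mul_norm_specProj_mul_le {R : Set ι} (hE : diagOp u ev + E = diagOp u' ev')
    (ha : ∀ i ∈ S, a ≤ ev' i) (hb : ∀ i ∈ R, ev i ≤ b) (hab : b < a) :
    (a - b) * ‖specProj u R * specProj u' S‖ ≤ ‖specProj u R * E * specProj u' S‖ := by
  classical
  -- After a shift by `c`, the operator `A - c` has norm at most `b - c` on the range of `P`.
  obtain ⟨c, hcb, hc⟩ : ∃ c ≤ b, ∀ i, c ≤ ev i := by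
    refine ⟨b - ∑ i, |ev i - b|, sub_le_self _ (Finset.sum_nonneg fun i _ => abs_nonneg _), fun i => ?_⟩
    have h1 := Finset.single_le_sum (fun i _ => abs_nonneg (ev i - b)) (Finset.mem_univ i)
    have h2 := neg_abs_le (ev i - b)
    linarith
  set P := specProj u R with hP
  set P' := specProj u' S with hP'
  set G := diagOp u' (S.indicator fun i => (ev' i - c)⁻¹) with hG
  set B := diagOp u (R.indicator fun i => ev i - c) with hB
  have hGn : ‖G‖ ≤ (a - c)⁻¹ := by
    refine norm_diagOp_le _ _ (by rw [inv_nonneg]; linarith) fun i => ?_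
    by_cases hi : i ∈ S
    · have := ha i hi
      rw [Set.indicator_of_mem hi, abs_of_nonneg (by rw [inv_nonneg]; linarith)]
      exact inv_anti₀ (by linarith) (by linarith)
    · rw [Set.indicator_of_notMem hi, abs_zero, inv_nonneg]; linarith
  have hBn : ‖B‖ ≤ b - c := by
    refine norm_diagOp_le _ _ (by linarith) fun i => ?_
    by_cases hi : i ∈ R
    · rw [Set.indicator_of_mem hi, abs_of_nonneg (by linarith [hc i])]
      linarith [hb i hi]
    · rw [Set.indicator_of_notMem hi, abs_zero]; linarith
  have hshift : ∀ (v : OrthonormalBasis ι ℝ V) (f : ι → ℝ),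
      diagOp v (fun i => f i - c) = diagOp v f - c • 1 := fun v f => by
    rw [← diagOp_one v, ← diagOp_smul, ← diagOp_sub]
    congr 1
    ext i
    simp
  have h1 : P' = (diagOp u' ev' - c • 1) * P' * G := by
    rw [← hshift, hP', hG, specProj, diagOp_mul, diagOp_mul]
    congr 1
    ext i
    by_cases hi : i ∈ S
    · have : ev' i - c ≠ 0 := by have := ha i hi; linarith
      simp [hi, this]
    · simp [hi]
  have h2 : P * (diagOp u ev - c • 1) = B * P := by
    rw [← hshift, hP, hB, specProj, diagOp_mul, diagOp_mul]
    congr 1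
    ext i
    by_cases hi : i ∈ R <;> simp [hi]
  have h3 : P * P' = (B * (P * P') + P * E * P') * G := by
    calc P * P' = P * ((diagOp u' ev' - c • 1) * P' * G) := by rw [← h1]
      _ = (P * (diagOp u ev - c • 1) * P' + P * E * P') * G := by rw [← hE]; noncomm_ring
      _ = _ := by rw [h2, mul_assoc B]
  have h4 : ‖P * P'‖ ≤ ((b - c) * ‖P * P'‖ + ‖P * E * P'‖) * (a - c)⁻¹ := by
    conv_lhs => rw [h3]
    refine (norm_mul_le _ _).trans ?_
    refine mul_le_mul ?_ hGn (norm_nonneg _) (by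
      have := norm_nonneg (P * P'); have := norm_nonneg (P * E * P')
      have : 0 ≤ b - c := by linarith
      positivity)
    refine (norm_add_le _ _).trans ?_
    gcongr
    refine (norm_mul_le _ _).trans ?_
    gcongr
  rw [← div_eq_mul_inv, le_div_iff₀ (by linarith)] at h4
  linarith

/-- The deterministic perturbation bound. The leading eigenvalues of `A = diagOp u ev` are those
indexed by `S`; they are at least `a > 0` while all others are at most `b`, and `y` bounds the
compression of `E` to the range of `A`. A vector of the range of `P'` leaves the range of `P`
either into the kernel of `A`, which costs `‖E‖ / a`, or inside the range of `A`, where only the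
compression of `E` and a second-order term through the kernel act against the gap `a - b`. -/
theorem norm_specProj_sub_le_of_gap (hE : diagOp u ev + E = diagOp u' ev')
    (ha : ∀ i ∈ S, a ≤ ev i) (hb : ∀ i ∉ S, ev i ≤ b) (hsep : ∀ i ∈ S, ∀ j ∉ S, ev' j ≤ ev' i)
    (ha0 : 0 < a) (hab : b < a)
    (hy : ‖specProj u {i | ev i ≠ 0} * E * specProj u {i | ev i ≠ 0}‖ ≤ y)
    (hya : 2 * y ≤ a - b) (hEa : 2 * ‖E‖ ≤ a) :
    ‖specProj u' S - specProj u S‖ ≤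
      4 * (2 * ‖E‖ / a + 2 * (y + 2 * ‖E‖ ^ 2 / a) / (a - b)) := by
  classical
  refine (norm_specProj_sub_le u S u').trans (mul_le_mul_of_nonneg_left ?_ (by norm_num))
  set N : Set ι := {i | ev i ≠ 0} with hN
  have hSN : S ⊆ N := fun i hi => by have := ha i hi; simp only [hN, Set.mem_ofPred_eq]; linarith
  have hquad : ∀ F : V →L[ℝ] V, ∀ x, -(‖F‖ * ‖x‖ ^ 2) ≤ ⟪x, F x⟫ := fun F x => by
    have h1 := neg_le_of_abs_le (abs_real_inner_le_norm x (F x))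
    have h2 := mul_le_mul_of_nonneg_left (F.le_opNorm x) (norm_nonneg x)
    nlinarith
  have hlow1 : ∀ i ∈ S, a / 2 ≤ ev' i := fun i hi => by
    have := sub_le_eigenvalue_of_inner_le hE ha hsep (fun x _ => hquad E x) hi
    linarith
  have hlow2 : ∀ i ∈ S, (a + b) / 2 ≤ ev' i := fun i hi => by
    have := sub_le_eigenvalue_of_inner_le (y := y) hE ha hsep (fun x hx => by
      have hxN : specProj u N x = x := by
        rw [← hx, ← mul_apply_eq_comp, specProj_mul_specProj,
          Set.inter_eq_right.mpr hSN]
      have h1 := hquad (specProj u N * E * specProj u N) x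
      rw [mul_apply_eq_comp, mul_apply_eq_comp, hxN,
        ← inner_specProj_left, hxN] at h1
      refine le_trans ?_ h1
      gcongr) hi
    linarith
  set P' := specProj u' S with hP'
  have hP'n : ‖P'‖ ≤ 1 := norm_specProj_le u' S
  -- The component in the kernel of `A`.
  have hker : ‖specProj u Nᶜ * P'‖ ≤ 2 * ‖E‖ / a := by
    have h := sub_mul_norm_specProj_mul_le (R := Nᶜ) hE hlow1 (b := 0)
      (fun i hi => by simp only [hN, Set.mem_compl_iff, Set.mem_ofPred_eq, not_not] at hi; exact hi.le)
      (by linarith)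
    have h2 : ‖specProj u Nᶜ * E * P'‖ ≤ ‖E‖ := by
      refine (norm_mul_le _ _).trans ((mul_le_of_le_one_right (norm_nonneg _) hP'n).trans ?_)
      exact (norm_mul_le _ _).trans (mul_le_of_le_one_left (norm_nonneg _) (norm_specProj_le u _))
    rw [le_div_iff₀ ha0]
    linarith
  -- The component in the range of `A`.
  have hran : ‖specProj u (N \ S) * P'‖ ≤ 2 * (y + 2 * ‖E‖ ^ 2 / a) / (a - b) := by
    have h := sub_mul_norm_specProj_mul_le (R := N \ S) hE hlow2 (b := b)
      (fun i hi => hb i hi.2) (by linarith)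
    have h2 : specProj u (N \ S) * E * P' =
        specProj u (N \ S) * (specProj u N * E * specProj u N) * P'
          + specProj u (N \ S) * E * (specProj u Nᶜ * P') := by
      have h3 : specProj u (N \ S) * specProj u N = specProj u (N \ S) := by
        rw [specProj_mul_specProj, Set.inter_eq_left.mpr Set.sdiff_subset]
      rw [← mul_assoc, ← mul_assoc, h3, specProj_compl]
      noncomm_ring
    have h3 : ‖specProj u (N \ S) * E * P'‖ ≤ y + 2 * ‖E‖ ^ 2 / a := by
      rw [h2]
      refine (norm_add_le _ _).trans (add_le_add ?_ ?_)
      · refine (norm_mul_le _ _).trans ((mul_le_of_le_one_right (norm_nonneg _) hP'n).trans ?_)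
        exact ((norm_mul_le _ _).trans
          (mul_le_of_le_one_left (norm_nonneg _) (norm_specProj_le u _))).trans hy
      · have h4 : ‖specProj u (N \ S) * E‖ ≤ ‖E‖ :=
          (norm_mul_le _ _).trans (mul_le_of_le_one_left (norm_nonneg _) (norm_specProj_le u _))
        calc _ ≤ ‖E‖ * (2 * ‖E‖ / a) :=
              (norm_mul_le _ _).trans (mul_le_mul h4 hker (norm_nonneg _) (norm_nonneg _))
          _ = _ := by ring
    rw [le_div_iff₀ (by linarith)]
    linarith
  have hdecomp : 1 - specProj u S = specProj u Nᶜ + specProj u (N \ S) := by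
    have h1 : specProj u (N \ S) = specProj u N * (1 - specProj u S) := by
      rw [← specProj_compl, specProj_mul_specProj, Set.sdiff_eq]
    have h2 : specProj u N * specProj u S = specProj u S := by
      rw [specProj_mul_specProj, Set.inter_eq_right.mpr hSN]
    rw [h1, mul_sub, h2, specProj_compl, mul_one]
    abel
  rw [hdecomp, add_mul]
  exact (norm_add_le _ _).trans (add_le_add hker hran)

/-- The triangle inequality over the `|N|²` rank-one terms of the compression of `E` to the span of
`u i`, `i ∈ N`; this is where the factor `r²` of the final bound comes from. -/
theorem norm_specProj_mul_mul_specProj_le (N : Finset ι) {x : ℝ}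
    (hx : ∀ i ∈ N, ∀ j ∈ N, |⟪u i, E (u j)⟫| ≤ x) :
    ‖specProj u (N : Set ι) * E * specProj u (N : Set ι)‖ ≤ (N.card : ℝ) ^ 2 * x := by
  classical
  have h1 : specProj u (N : Set ι) * E * specProj u (N : Set ι) =
      ∑ i ∈ N, ∑ j ∈ N, ⟪u i, E (u j)⟫ • rankOne ℝ (u i) (u j) := by
    have h2 : specProj u (N : Set ι) = ∑ i ∈ N, rankOne ℝ (u i) (u i) := by
      rw [specProj, diagOp, ← Finset.sum_subset (Finset.subset_univ N)]
      · exact Finset.sum_congr rfl fun i hi => by simp [hi]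
      · intro i _ hi
        simp [hi]
    rw [h2, Finset.sum_mul, Finset.sum_mul_sum]
    refine Finset.sum_congr rfl fun i _ => Finset.sum_congr rfl fun j _ => ?_
    ext z
    simp [smul_smul, mul_comm]
  rw [h1]
  refine (norm_sum_le _ _).trans ?_
  calc ∑ i ∈ N, ‖∑ j ∈ N, ⟪u i, E (u j)⟫ • rankOne ℝ (u i) (u j)‖
      ≤ ∑ i ∈ N, ∑ j ∈ N, x := by
        refine Finset.sum_le_sum fun i hi => (norm_sum_le _ _).trans ?_
        refine Finset.sum_le_sum fun j hj => ?_
        rw [norm_smul, norm_rankOne, u.norm_eq_one, u.norm_eq_one, Real.norm_eq_abs]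
        simpa using hx i hi j hj
    _ = _ := by simp; ring

end Perturbation

end Diagonal

/-! ### Bilinear forms of a Wigner matrix are sub-Gaussian -/

section Tail

variable {Ω : Type*} [MeasurableSpace Ω] {μ : Measure Ω} {n : ℕ}
  {E : Ω → Matrix (Fin n) (Fin n) ℝ} {K : ℝ≥0}

theorem HasSubgaussianMGF.mono_param {X : Ω → ℝ} {c d : ℝ≥0} (h : HasSubgaussianMGF X c μ)
    (hcd : c ≤ d) : HasSubgaussianMGF X d μ :=
  ⟨h.integrable_exp_mul, fun t => (h.mgf_le t).trans (by gcongr)⟩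

theorem HasSubgaussianMGF.measure_abs_ge_le {X : Ω → ℝ} {c : ℝ≥0} (h : HasSubgaussianMGF X c μ)
    {t : ℝ} (ht : 0 ≤ t) :
    μ.real {ω | t ≤ |X ω|} ≤ 2 * Real.exp (-t ^ 2 / (2 * c)) := by
  have h1 : {ω | t ≤ |X ω|} = {ω | t ≤ X ω} ∪ {ω | t ≤ (-X) ω} := by
    ext ω; simp [le_abs]
  rw [h1, two_mul]
  exact (measureReal_union_le _ _).trans
    (add_le_add (h.measure_ge_le ht) (h.neg.measure_ge_le ht))

/-- A bilinear form of a symmetric matrix as a sum over the entries on and above the diagonal. -/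
theorem dotProduct_mulVec_eq_sum_upper {M : Matrix (Fin n) (Fin n) ℝ} (hM : M.IsSymm)
    (a b : Fin n → ℝ) :
    a ⬝ᵥ M *ᵥ b = ∑ q : {q : Fin n × Fin n // q.1 ≤ q.2},
      (a q.1.1 * b q.1.2 + if q.1.1 < q.1.2 then a q.1.2 * b q.1.1 else 0) * M q.1.1 q.1.2 := by
  have hlow : ∑ i, ∑ j, (if j < i then a i * M i j * b j else 0) =
      ∑ i, ∑ j, if i < j then a j * b i * M i j else 0 := by
    rw [Finset.sum_comm]
    refine Finset.sum_congr rfl fun i _ => Finset.sum_congr rfl fun j _ => ?_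
    rw [hM.apply i j]
    split_ifs <;> ring
  have hsub := Finset.sum_subtype_eq_sum_filter (s := Finset.univ)
    (p := fun q : Fin n × Fin n => q.1 ≤ q.2) (fun q =>
      (a q.1 * b q.2 + if q.1 < q.2 then a q.2 * b q.1 else 0) * M q.1 q.2)
  rw [Finset.subtype_univ] at hsub
  rw [hsub, Finset.sum_filter, Fintype.sum_prod_type]
  calc a ⬝ᵥ M *ᵥ b = ∑ i, ∑ j, a i * M i j * b j := by
        simp [dotProduct, Matrix.mulVec, Finset.mul_sum, mul_assoc]
    _ = ∑ i, ∑ j, (if i ≤ j then a i * b j * M i j else 0) +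
        ∑ i, ∑ j, (if j < i then a i * M i j * b j else 0) := by
        rw [← Finset.sum_add_distrib]
        refine Finset.sum_congr rfl fun i _ => ?_
        rw [← Finset.sum_add_distrib]
        refine Finset.sum_congr rfl fun j _ => ?_
        rcases le_or_gt i j with h | h
        · simp [h, not_lt.mpr h]; ring
        · simp [h, not_le.mpr h]
    _ = _ := by
        rw [hlow, ← Finset.sum_add_distrib]
        refine Finset.sum_congr rfl fun i _ => ?_
        rw [← Finset.sum_add_distrib]
        refine Finset.sum_congr rfl fun j _ => ?_
        rcases lt_trichotomy i j with h | h | h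
        · simp [h, h.le]; ring
        · simp [h]
        · simp [not_le.mpr h, not_lt.mpr h.le]

theorem sum_upper_sq_le (a b : EuclideanSpace ℝ (Fin n)) :
    ∑ q : {q : Fin n × Fin n // q.1 ≤ q.2},
      (a q.1.1 * b q.1.2 + if q.1.1 < q.1.2 then a q.1.2 * b q.1.1 else 0) ^ 2 ≤
        2 * (‖a‖ ^ 2 * ‖b‖ ^ 2) := by
  have hsub := Finset.sum_subtype_eq_sum_filter (s := Finset.univ)
    (p := fun q : Fin n × Fin n => q.1 ≤ q.2) (fun q =>
      (a q.1 * b q.2 + if q.1 < q.2 then a q.2 * b q.1 else 0) ^ 2)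
  rw [Finset.subtype_univ] at hsub
  rw [hsub, Finset.sum_filter, Fintype.sum_prod_type]
  have hswap : ∑ i, ∑ j, (if j < i then (a i * b j) ^ 2 else 0) =
      ∑ i, ∑ j, if i < j then (a j * b i) ^ 2 else 0 := Finset.sum_comm
  calc _ ≤ ∑ i, ∑ j, 2 * ((if i ≤ j then (a i * b j) ^ 2 else 0) +
          if i < j then (a j * b i) ^ 2 else 0) := by
        refine Finset.sum_le_sum fun i _ => Finset.sum_le_sum fun j _ => ?_
        rcases lt_trichotomy i j with h | h | h
        · simp only [h, h.le, if_true]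
          nlinarith [sq_nonneg (a i * b j - a j * b i)]
        · simp only [h, le_refl, lt_irrefl, if_true, if_false]
          nlinarith [sq_nonneg (a j * b j)]
        · simp [not_le.mpr h, not_lt.mpr h.le]
    _ = 2 * ∑ i, ∑ j, (a i * b j) ^ 2 := by
        simp only [← Finset.mul_sum, Finset.sum_add_distrib]
        rw [← hswap, ← Finset.sum_add_distrib]
        congr 1
        refine Finset.sum_congr rfl fun i _ => ?_
        rw [← Finset.sum_add_distrib]
        refine Finset.sum_congr rfl fun j _ => ?_
        rcases le_or_gt i j with h | h
        · simp [h, not_lt.mpr h]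
        · simp [h, not_le.mpr h]
    _ = _ := by
        rw [EuclideanSpace.real_norm_sq_eq, EuclideanSpace.real_norm_sq_eq, Finset.sum_mul_sum]
        simp [mul_pow]

theorem IsWigner.hasSubgaussianMGF_dotProduct (hE : IsWigner E K μ)
    (a b : EuclideanSpace ℝ (Fin n)) {c : ℝ≥0} (hc : 2 * (‖a‖ ^ 2 * ‖b‖ ^ 2) * K ≤ c) :
    HasSubgaussianMGF (fun ω => a.ofLp ⬝ᵥ E ω *ᵥ b.ofLp) c μ := by
  let d : {q : Fin n × Fin n // q.1 ≤ q.2} → ℝ := fun q =>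
    a q.1.1 * b q.1.2 + if q.1.1 < q.1.2 then a q.1.2 * b q.1.1 else 0
  have h1 : iIndepFun (fun (q : {q : Fin n × Fin n // q.1 ≤ q.2}) ω =>
      d q * E ω q.1.1 q.1.2) μ :=
    hE.indep.comp (fun q x => d q * x) fun q => measurable_const_mul _
  have h2 := HasSubgaussianMGF.sum_of_iIndepFun h1 (s := Finset.univ)
    (fun q _ => (hE.subgaussian q.1.1 q.1.2 q.2).const_mul (d q))
  have h3 : (fun ω => a.ofLp ⬝ᵥ E ω *ᵥ b.ofLp) = fun ω => ∑ q, d q * E ω q.1.1 q.1.2 := by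
    ext ω
    exact dotProduct_mulVec_eq_sum_upper (hE.symm ω) _ _
  rw [h3]
  refine HasSubgaussianMGF.mono_param h2 ?_
  rw [← NNReal.coe_le_coe]
  refine le_trans ?_ hc
  calc _ = ∑ q, d q ^ 2 * (K : ℝ) := by rw [NNReal.coe_sum]; rfl
    _ = (∑ q, d q ^ 2) * K := (Finset.sum_mul _ _ _).symm
    _ ≤ _ := ?_
  gcongr
  exact sum_upper_sq_le a b

end Tail

/-! ### A grid net and the spectral norm of a Wigner matrix -/

/-- The points of the grid `(2√n)⁻¹ ℤⁿ` in the ball of radius `2` approximate the points of the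
unit ball within `1 / 4`. -/
theorem exists_grid_net (n : ℕ) (hn : 1 ≤ n) :
    ∃ N : Finset (EuclideanSpace ℝ (Fin n)), N.card ≤ (4 * n + 3) ^ n ∧ (∀ w ∈ N, ‖w‖ ≤ 2) ∧
      ∀ x : EuclideanSpace ℝ (Fin n), ‖x‖ ≤ 1 → ∃ w ∈ N, ‖x - w‖ ≤ 1 / 4 := by
  classical
  let pt : (Fin n → ℤ) → EuclideanSpace ℝ (Fin n) := fun z =>
    WithLp.toLp 2 fun i => (z i : ℝ) / (2 * √n)
  let G : Finset (Fin n → ℤ) :=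
    Fintype.piFinset fun _ => Finset.Icc (-(2 * n + 1) : ℤ) (2 * n + 1)
  have hn1 : (1 : ℝ) ≤ n := by exact_mod_cast hn
  have hs : 0 < √(n : ℝ) := Real.sqrt_pos.mpr (by linarith)
  have hss : √(n : ℝ) * √n = n := Real.mul_self_sqrt (by linarith)
  have hsn : √(n : ℝ) ≤ n := by nlinarith [Real.sqrt_nonneg (n : ℝ)]
  refine ⟨(G.image pt).filter fun w => ‖w‖ ≤ 2, ?_, fun w hw => (Finset.mem_filter.mp hw).2,
    fun x hx => ?_⟩
  · refine (Finset.card_filter_le _ _).trans (Finset.card_image_le.trans (le_of_eq ?_))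
    rw [Fintype.card_piFinset]
    simp only [Int.card_Icc, Finset.prod_const, Finset.card_univ, Fintype.card_fin]
    congr 1
    omega
  · let z : Fin n → ℤ := fun i => round (2 * √n * x i)
    have hclose : ‖x - pt z‖ ≤ 1 / 4 := by
      refine le_of_sq_le_sq ?_ (by norm_num)
      rw [EuclideanSpace.real_norm_sq_eq]
      calc ∑ i, (x - pt z) i ^ 2 ≤ ∑ _i : Fin n, (1 / 4) ^ 2 * (1 / n : ℝ) := by
            refine Finset.sum_le_sum fun i _ => ?_
            have h1 := abs_sub_round (2 * √n * x i)
            have h2 : (x - pt z) i = (2 * √n * x i - round (2 * √n * x i)) / (2 * √n) := by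
              simp only [pt, z, PiLp.sub_apply]
              field_simp
            rw [h2, div_pow, ← sq_abs, mul_pow, pow_two √(n : ℝ), hss,
              div_le_iff₀ (by positivity)]
            have h3 : |2 * √n * x i - round (2 * √n * x i)| ^ 2 ≤ (1 / 2) ^ 2 := by gcongr
            refine h3.trans (le_of_eq ?_)
            field_simp
            norm_num
        _ = (1 / 4) ^ 2 := by
            simp only [Finset.sum_const, Finset.card_univ, Fintype.card_fin, nsmul_eq_mul]
            field_simp
    refine ⟨pt z, Finset.mem_filter.mpr ⟨Finset.mem_image_of_mem _ ?_, ?_⟩, hclose⟩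
    · rw [Fintype.mem_piFinset]
      intro i
      have h1 := abs_le.mp (abs_sub_round (2 * √n * x i))
      have h2 := abs_le.mp ((PiLp.norm_apply_le x i).trans hx)
      have h3 : 2 * √n * x i ≤ 2 * n := by nlinarith
      have h4 : -(2 * n) ≤ 2 * √n * x i := by nlinarith
      rw [Finset.mem_Icc]
      constructor
      · have : (-(2 * n + 1) : ℝ) ≤ z i := by simp only [z]; linarith
        exact_mod_cast this
      · have : (z i : ℝ) ≤ 2 * n + 1 := by simp only [z]; linarith
        exact_mod_cast this
    · have : ‖pt z‖ ≤ ‖x‖ + ‖x - pt z‖ := by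
        simpa using norm_sub_le x (x - pt z)
      linarith

open scoped RealInnerProductSpace in
/-- A net of the unit ball within `1 / 4` and of radius `2` determines the norm of an operator up
to a factor `4`. -/
theorem norm_le_of_net {V : Type*} [NormedAddCommGroup V] [InnerProductSpace ℝ V]
    (N : Finset V) (hN2 : ∀ w ∈ N, ‖w‖ ≤ 2) (hN : ∀ x : V, ‖x‖ ≤ 1 → ∃ w ∈ N, ‖x - w‖ ≤ 1 / 4)
    (T : V →L[ℝ] V) {t : ℝ} (ht : 0 ≤ t) (h : ∀ v ∈ N, ∀ w ∈ N, |⟪v, T w⟫| ≤ t) :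
    ‖T‖ ≤ 4 * t := by
  have h0 : ‖T‖ ≤ t + 3 / 4 * ‖T‖ := by
    refine ContinuousLinearMap.opNorm_le_of_re_inner_le (by positivity) fun y x hy hx => ?_
    obtain ⟨v, hv, hxv⟩ := hN x hx.le
    obtain ⟨w, hw, hyw⟩ := hN y hy.le
    have hsplit : ⟪x, T y⟫ = ⟪v, T w⟫ + ⟪x - v, T w⟫ + ⟪x, T (y - w)⟫ := by
      simp only [inner_sub_left, map_sub, inner_sub_right]; ring
    have h1 := le_of_abs_le (h v hv w hw)
    have h2 : ⟪x - v, T w⟫ ≤ 1 / 4 * (‖T‖ * 2) :=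
      (real_inner_le_norm _ _).trans (mul_le_mul hxv ((T.le_opNorm w).trans
        (mul_le_mul_of_nonneg_left (hN2 w hw) (norm_nonneg _))) (norm_nonneg _) (by norm_num))
    have h3 : ⟪x, T (y - w)⟫ ≤ 1 * (‖T‖ * (1 / 4)) :=
      (real_inner_le_norm _ _).trans (mul_le_mul hx.le ((T.le_opNorm _).trans
        (mul_le_mul_of_nonneg_left hyw (norm_nonneg _))) (norm_nonneg _) (by norm_num))
    change ⟪T y, x⟫ ≤ _
    rw [real_inner_comm, hsplit]
    linarith
  linarith

section WignerNorm

variable {Ω : Type*} [MeasurableSpace Ω] {μ : Measure Ω} {n : ℕ}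
  {E : Ω → Matrix (Fin n) (Fin n) ℝ} {K : ℝ≥0}

/-- Union bound for the bilinear forms of a Wigner matrix over a finite set of vectors. -/
theorem IsWigner.measure_exists_ge_le (hE : IsWigner E K μ)
    (N : Finset (EuclideanSpace ℝ (Fin n))) {ρ : ℝ} (hN : ∀ w ∈ N, ‖w‖ ≤ ρ) {c : ℝ≥0}
    (hc : 2 * ρ ^ 4 * K ≤ c) {t : ℝ} (ht : 0 ≤ t) :
    μ.real {ω | ∃ v ∈ N, ∃ w ∈ N, t ≤ |v.ofLp ⬝ᵥ E ω *ᵥ w.ofLp|} ≤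
      (N.card : ℝ) ^ 2 * (2 * Real.exp (-t ^ 2 / (2 * c))) := by
  have h1 : {ω | ∃ v ∈ N, ∃ w ∈ N, t ≤ |v.ofLp ⬝ᵥ E ω *ᵥ w.ofLp|} =
      ⋃ q ∈ N ×ˢ N, {ω | t ≤ |q.1.ofLp ⬝ᵥ E ω *ᵥ q.2.ofLp|} := by
    ext ω
    simp only [Set.mem_ofPred_eq, Set.mem_iUnion, Finset.mem_product, Prod.exists]
    constructor
    · rintro ⟨v, hv, w, hw, h⟩
      exact ⟨v, w, ⟨hv, hw⟩, h⟩
    · rintro ⟨v, w, ⟨hv, hw⟩, h⟩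
      exact ⟨v, hv, w, hw, h⟩
  rw [h1]
  refine (measureReal_biUnion_finset_le _ _).trans ?_
  refine (Finset.sum_le_card_nsmul _ _ (2 * Real.exp (-t ^ 2 / (2 * c))) fun q hq => ?_).trans ?_
  · obtain ⟨h2, h3⟩ := Finset.mem_product.mp hq
    refine HasSubgaussianMGF.measure_abs_ge_le (hE.hasSubgaussianMGF_dotProduct _ _ ?_) ht
    refine le_trans ?_ hc
    have h4 : ‖q.1‖ ^ 2 * ‖q.2‖ ^ 2 ≤ ρ ^ 2 * ρ ^ 2 := by
      gcongr
      · exact hN _ h2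
      · exact hN _ h3
    have h5 : ρ ^ 4 = ρ ^ 2 * ρ ^ 2 := by ring
    rw [h5]
    gcongr
  · rw [Finset.card_product, nsmul_eq_mul]
    push_cast
    rw [← pow_two]

/-- The spectral norm of a Wigner matrix is `O(√(n log n))` with high probability. The true order
is `√n`; the logarithm pays for the crude cardinality of the grid. -/
theorem IsWigner.measure_norm_ge_le [IsFiniteMeasure μ] (hE : IsWigner E K μ) (hn : 3 ≤ n) :
    μ.real {ω | 4 * √(512 * (K + 1) * (n * Real.log n)) < ‖E ω‖} ≤ 2 / n := by
  obtain ⟨N, hcard, hN2, hN⟩ := exists_grid_net n (by omega)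
  have hn3 : (3 : ℝ) ≤ n := by exact_mod_cast hn
  have hlog : 0 ≤ Real.log n := Real.log_nonneg (by linarith)
  have hK : (0 : ℝ) < K + 1 := by positivity
  set t := √(512 * (K + 1) * (n * Real.log n)) with ht
  have htt : t ^ 2 = 512 * (K + 1) * (n * Real.log n) := Real.sq_sqrt (by positivity)
  have hsub : {ω | 4 * t < ‖E ω‖} ⊆ {ω | ∃ v ∈ N, ∃ w ∈ N, t ≤ |v.ofLp ⬝ᵥ E ω *ᵥ w.ofLp|} := by
    intro ω hω
    by_contra hcon
    simp only [Set.mem_ofPred_eq, not_exists, not_and, not_le] at hcon hω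
    refine absurd hω (not_lt.mpr ?_)
    rw [← Matrix.l2_opNorm_toEuclideanCLM (𝕜 := ℝ)]
    refine norm_le_of_net N hN2 hN _ (Real.sqrt_nonneg _) fun v hv w hw => ?_
    have := (hcon v hv w hw).le
    rw [dotProduct_comm] at this
    simpa [EuclideanSpace.inner_eq_star_dotProduct] using this
  refine (measureReal_mono hsub).trans ?_
  refine (hE.measure_exists_ge_le N (ρ := 2) (c := 32 * (K + 1)) hN2
    (by push_cast; linarith) (Real.sqrt_nonneg _)).trans ?_
  have hexp : -t ^ 2 / (2 * ((32 * (K + 1) : ℝ≥0) : ℝ)) = -(8 * n * Real.log n) := by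
    rw [htt]; push_cast; field_simp; ring
  rw [hexp]
  have hNc : (N.card : ℝ) ≤ Real.exp (3 * n * Real.log n) := by
    calc (N.card : ℝ) ≤ (4 * n + 3) ^ n := by exact_mod_cast hcard
      _ ≤ ((n : ℝ) ^ 3) ^ n := by gcongr; nlinarith [sq_nonneg ((n : ℝ) - 3)]
      _ = Real.exp (3 * n * Real.log n) := by
        rw [← pow_mul, ← Real.rpow_natCast, Real.rpow_def_of_pos (by linarith)]
        push_cast
        ring_nf
  calc (N.card : ℝ) ^ 2 * (2 * Real.exp (-(8 * n * Real.log n)))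
      ≤ Real.exp (3 * n * Real.log n) ^ 2 * (2 * Real.exp (-(8 * n * Real.log n))) := by gcongr
    _ = 2 * Real.exp (-(2 * n * Real.log n)) := by
        rw [← Real.exp_nat_mul, mul_left_comm, ← Real.exp_add]
        push_cast
        ring_nf
    _ ≤ 2 * Real.exp (-Real.log n) := by gcongr; nlinarith
    _ = 2 / n := by rw [Real.exp_neg, Real.exp_log (by linarith)]; ring

/-- The entries of a Wigner matrix in a fixed orthonormal basis are `O(√(log n))` with high
probability. -/
theorem IsWigner.measure_exists_basis_ge_le (hE : IsWigner E K μ) (hn : 3 ≤ n)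
    (u : OrthonormalBasis (Fin n) ℝ (EuclideanSpace ℝ (Fin n))) :
    μ.real {ω | ∃ i j, √(12 * (K + 1) * Real.log n) ≤ |(u i).ofLp ⬝ᵥ E ω *ᵥ (u j).ofLp|} ≤
      2 / n := by
  classical
  have hn3 : (3 : ℝ) ≤ n := by exact_mod_cast hn
  have hlog : 0 ≤ Real.log n := Real.log_nonneg (by linarith)
  have hK : (0 : ℝ) < K + 1 := by positivity
  set t := √(12 * (K + 1) * Real.log n) with ht
  have htt : t ^ 2 = 12 * (K + 1) * Real.log n := Real.sq_sqrt (by positivity)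
  have hset : {ω | ∃ i j, t ≤ |(u i).ofLp ⬝ᵥ E ω *ᵥ (u j).ofLp|} =
      {ω | ∃ v ∈ Finset.univ.image u, ∃ w ∈ Finset.univ.image u,
        t ≤ |v.ofLp ⬝ᵥ E ω *ᵥ w.ofLp|} := by
    ext ω; simp
  rw [hset]
  refine (hE.measure_exists_ge_le (Finset.univ.image u) (ρ := 1) (c := 2 * (K + 1))
    (by simp) (by push_cast; linarith) (Real.sqrt_nonneg _)).trans ?_
  have hexp : -t ^ 2 / (2 * ((2 * (K + 1) : ℝ≥0) : ℝ)) = -(3 * Real.log n) := by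
    rw [htt]; push_cast; field_simp; ring
  have hcard : ((Finset.univ.image u).card : ℝ) ≤ n := by
    exact_mod_cast Finset.card_image_le.trans (by simp)
  rw [hexp]
  calc _ ≤ (n : ℝ) ^ 2 * (2 * Real.exp (-(3 * Real.log n))) := by gcongr
    _ = 2 / n := by
      have h0 : (n : ℝ) ≠ 0 := by linarith
      have h3 : Real.exp (3 * Real.log n) = (n : ℝ) ^ 3 := by
        rw [← Real.exp_log (show (0 : ℝ) < n by linarith), ← Real.exp_nat_mul, Real.log_exp]
        norm_num
      rw [Real.exp_neg, h3]
      field_simp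

end WignerNorm

/-! ### The perturbation bound for matrices -/

section Matrices

open scoped RealInnerProductSpace

variable {n : ℕ} {A E : Matrix (Fin n) (Fin n) ℝ} {ev ev' : Fin n → ℝ}
  {u u' : OrthonormalBasis (Fin n) ℝ (EuclideanSpace ℝ (Fin n))}

theorem IsSpectralDecomposition.toEuclideanCLM_eq (h : IsSpectralDecomposition A ev u) :
    Matrix.toEuclideanCLM (𝕜 := ℝ) A = diagOp u ev := by
  refine eq_diagOp u ev fun i => ?_
  apply WithLp.ofLp_injective 2
  rw [Matrix.ofLp_toEuclideanCLM, h.mulVec_eq, WithLp.ofLp_smul]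

theorem toEuclideanCLM_leadingProj (u : OrthonormalBasis (Fin n) ℝ (EuclideanSpace ℝ (Fin n)))
    (p : ℕ) : Matrix.toEuclideanCLM (𝕜 := ℝ) (leadingProj u p) = specProj u {i | i.val < p} := by
  refine eq_diagOp u _ fun j => ?_
  apply WithLp.ofLp_injective 2
  have horth : ∀ i, (u i).ofLp ⬝ᵥ (u j).ofLp = if i = j then 1 else 0 := fun i => by
    rw [← orthonormal_iff_ite.mp u.orthonormal i j, EuclideanSpace.inner_eq_star_dotProduct,
      dotProduct_comm, star_trivial]
  rw [Matrix.ofLp_toEuclideanCLM, leadingProj, Matrix.sum_mulVec, WithLp.ofLp_smul,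
    Set.indicator_apply, Finset.sum_filter]
  rw [Finset.sum_eq_single j (fun i _ hij => by simp [Matrix.vecMulVec_mulVec, horth, hij])
    (by simp)]
  simp [Matrix.vecMulVec_mulVec, horth]

theorem IsSpectralDecomposition.card_ne_zero_le_rank (h : IsSpectralDecomposition A ev u) :
    (Finset.univ.filter fun i => ev i ≠ 0).card ≤ A.rank := by
  classical
  have hmem : ∀ i : {i // ev i ≠ 0}, (u i).ofLp ∈ LinearMap.range A.mulVecLin := fun i =>
    ⟨(ev i)⁻¹ • (u i).ofLp, by
      rw [Matrix.mulVecLin_apply, Matrix.mulVec_smul, h.mulVec_eq, smul_smul,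
        inv_mul_cancel₀ i.2, one_smul]⟩
  have hli : LinearIndependent ℝ fun i : {i // ev i ≠ 0} =>
      (⟨(u i).ofLp, hmem i⟩ : LinearMap.range A.mulVecLin) := by
    have h1 := u.orthonormal.linearIndependent.comp (fun i : {i // ev i ≠ 0} => (i : Fin n))
      Subtype.val_injective
    have h2 := h1.map' (WithLp.linearEquiv 2 ℝ (Fin n → ℝ)).toLinearMap (LinearEquiv.ker _)
    exact LinearIndependent.of_comp (LinearMap.range A.mulVecLin).subtype h2
  have := hli.fintype_card_le_finrank
  rwa [Fintype.card_subtype] at this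

/-- The deterministic bound with `x` controlling the entries of `E` in the eigenbasis of `A`. If
`λ_p < 0`, the matrix `-A`, whose leading eigenvalues are the negatives of the trailing ones of
`A`, satisfies the hypotheses with `-λ_{p+1} > |λ_p|` as smallest leading eigenvalue. -/
theorem norm_leadingProj_sub_le (hu : IsSpectralDecomposition A ev u)
    (hu' : IsSpectralDecomposition (A + E) ev' u') {p : ℕ} (hp : 1 ≤ p) (hpn : p < n)
    {lam δ x : ℝ} (hlam : lam = ev ⟨p - 1, by omega⟩) (hδ : δ = lam - ev ⟨p, hpn⟩)
    (hlam0 : lam ≠ 0) (hδ0 : 0 < δ) (hx : ∀ i j, |(u i).ofLp ⬝ᵥ E *ᵥ (u j).ofLp| ≤ x)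
    (hrx : 2 * ((A.rank : ℝ) ^ 2 * x) ≤ δ) (hE : 2 * ‖E‖ ≤ |lam|) :
    ‖leadingProj u' p - leadingProj u p‖ ≤
      4 * (2 * ‖E‖ / |lam| + 2 * ((A.rank : ℝ) ^ 2 * x + 2 * ‖E‖ ^ 2 / |lam|) / δ) := by
  classical
  set T := Matrix.toEuclideanCLM (𝕜 := ℝ) E with hT
  have hTn : ‖T‖ = ‖E‖ := Matrix.l2_opNorm_toEuclideanCLM E
  have hx0 : 0 ≤ x := (abs_nonneg _).trans (hx ⟨p, hpn⟩ ⟨p, hpn⟩)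
  have hsum : diagOp u ev + T = diagOp u' ev' := by
    rw [← hu.toEuclideanCLM_eq, ← hu'.toEuclideanCLM_eq, hT, map_add]
  set S : Set (Fin n) := {i | i.val < p} with hS
  have hSle : ∀ i ∈ S, lam ≤ ev i := fun i hi => by
    rw [hlam]
    refine hu.antitone (Fin.mk_le_mk.mpr ?_ : i ≤ ⟨p - 1, _⟩)
    have : i.val < p := hi
    omega
  have hSge : ∀ i ∉ S, ev i ≤ lam - δ := fun i hi => by
    rw [hδ, sub_sub_cancel]
    exact hu.antitone (Fin.mk_le_mk.mpr (not_lt.mp hi))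
  have hsep : ∀ i ∈ S, ∀ j ∉ S, ev' j ≤ ev' i := fun i hi j hj =>
    hu'.antitone (Fin.le_def.mpr (le_of_lt (lt_of_lt_of_le hi (not_lt.mp hj))))
  rw [← Matrix.l2_opNorm_toEuclideanCLM (𝕜 := ℝ), map_sub, toEuclideanCLM_leadingProj,
    toEuclideanCLM_leadingProj, ← hTn]
  rw [← hTn] at hE
  have hy : ‖specProj u {i | ev i ≠ 0} * T * specProj u {i | ev i ≠ 0}‖ ≤
      (A.rank : ℝ) ^ 2 * x := by
    have h1 := norm_specProj_mul_mul_specProj_le (u := u) (E := T) (x := x)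
      (Finset.univ.filter fun i => ev i ≠ 0) fun i _ j _ => by
        have := hx i j
        rw [dotProduct_comm] at this
        simpa [EuclideanSpace.inner_eq_star_dotProduct, hT] using this
    rw [Finset.coe_filter_univ] at h1
    refine h1.trans ?_
    gcongr
    exact hu.card_ne_zero_le_rank
  rcases hlam0.lt_or_gt with hneg | hpos
  · have hN : {i | (-ev) i ≠ 0} = {i | ev i ≠ 0} := by ext i; simp
    have h := norm_specProj_sub_le_of_gap (u := u) (u' := u') (S := Sᶜ) (ev := -ev) (ev' := -ev')
      (E := -T) (a := δ - lam) (b := -lam) (y := (A.rank : ℝ) ^ 2 * x)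
      (by rw [diagOp_neg, diagOp_neg, ← hsum]; abel)
      (fun i hi => by have := hSge i hi; simp only [Pi.neg_apply]; linarith)
      (fun i hi => neg_le_neg (hSle i (not_not.mp hi)))
      (fun i hi j hj => neg_le_neg (hsep j (not_not.mp hj) i hi))
      (by linarith) (by linarith)
      (by rw [hN, mul_neg, neg_mul, norm_neg]; exact hy)
      (by linarith) (by rw [norm_neg]; rw [abs_of_neg hneg] at hE; linarith)
    rw [specProj_compl, specProj_compl, sub_sub_sub_cancel_left, norm_sub_rev, norm_neg,
      show δ - lam - -lam = δ by ring] at h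
    refine h.trans ?_
    have h2 : |lam| ≤ δ - lam := by rw [abs_of_neg hneg]; linarith
    have h3 : 0 < |lam| := abs_pos.mpr hlam0
    gcongr
  · rw [abs_of_pos hpos] at hE ⊢
    have h := norm_specProj_sub_le_of_gap hsum hSle hSge hsep hpos (by linarith) hy
      (by linarith) hE
    rwa [sub_sub_cancel] at h

theorem norm_leadingProj_sub_le_two (p : ℕ) : ‖leadingProj u' p - leadingProj u p‖ ≤ 2 := by
  rw [← Matrix.l2_opNorm_toEuclideanCLM (𝕜 := ℝ), map_sub, toEuclideanCLM_leadingProj,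
    toEuclideanCLM_leadingProj]
  refine (norm_sub_le _ _).trans ?_
  linarith [norm_specProj_le u {i : Fin n | i.val < p}, norm_specProj_le u' {i : Fin n | i.val < p}]

end Matrices

/-- Bookkeeping of constants: the deterministic bound holds up to the factor `1000 κ L` under the
high-probability bounds, where `L` stands for `log n`, and if its smallness conditions fail, the
right-hand side exceeds the trivial bound `2`. -/
theorem le_of_deterministic_bound {κ L s δ l e x ρ d : ℝ} (hκ : 1 ≤ κ) (hL : 1 ≤ L)
    (hs : 0 < s) (hδ : 2.01 * s ≤ δ) (hl : 0 < l) (he0 : 0 ≤ e) (hρ : 0 ≤ ρ)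
    (he : e ≤ 92 * (κ * L) * s) (hx : x ≤ 4 * (κ * L)) (hd2 : d ≤ 2)
    (hd : 2 * (ρ * x) ≤ δ → 2 * e ≤ l → d ≤ 4 * (2 * e / l + 2 * (ρ * x + 2 * e ^ 2 / l) / δ)) :
    d ≤ 1000 * κ * L * (e / l + ρ / δ) := by
  have hδ0 : 0 < δ := by linarith
  have hκL : 1 ≤ κ * L := one_le_mul_of_one_le_of_one_le hκ hL
  have hel : 0 ≤ e / l := by positivity
  have hρδ : 0 ≤ ρ / δ := by positivity
  by_cases h1 : 2 * e ≤ l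
  · by_cases h2 : 2 * (ρ * x) ≤ δ
    · refine (hd h2 h1).trans ?_
      have h3 : e / δ ≤ 46 * (κ * L) := by
        rw [div_le_iff₀ hδ0]
        have : 92 * (κ * L) * s ≤ 92 * (κ * L) * (δ / 2) := by gcongr; linarith
        linarith
      have h4 : ρ / δ * x ≤ ρ / δ * (4 * (κ * L)) := by gcongr
      have h5 : e / l * (e / δ) ≤ e / l * (46 * (κ * L)) := by gcongr
      have h6 : 4 * (2 * e / l + 2 * (ρ * x + 2 * e ^ 2 / l) / δ) =
          8 * (e / l) + 8 * (ρ / δ * x) + 16 * (e / l * (e / δ)) := by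
        field_simp; ring
      rw [h6]
      nlinarith [mul_le_mul_of_nonneg_left hκL hel, mul_nonneg hρδ (zero_le_one.trans hκL)]
    · push Not at h2
      have h3 : 1 ≤ ρ / δ * (8 * (κ * L)) := by
        have : ρ / δ * (8 * (κ * L)) = ρ * (8 * (κ * L)) / δ := by ring
        rw [this, le_div_iff₀ hδ0]
        have : ρ * x ≤ ρ * (4 * (κ * L)) := by gcongr
        linarith
      nlinarith [mul_nonneg hel (zero_le_one.trans hκL)]
  · push Not at h1
    have h3 : 1 / 2 ≤ e / l := by rw [le_div_iff₀ hl]; linarith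
    nlinarith [mul_nonneg hρδ (zero_le_one.trans hκL),
      mul_le_mul h3 hκL zero_le_one hel]

theorem corollary3p3 (K : ℝ≥0) :
    ∃ (C : ℝ) (k : ℕ) (ε : ℕ → ℝ), Tendsto ε atTop (𝓝 0) ∧
      ∀ {Ω : Type*} [MeasurableSpace Ω] (μ : Measure Ω) [IsProbabilityMeasure μ]
        (n r p : ℕ) (hp : 1 ≤ p) (hpn : p < n)
        (A : Matrix (Fin n) (Fin n) ℝ) (_hA : A.IsSymm) (_hr : A.rank = r)
        (ev : Fin n → ℝ) (u : OrthonormalBasis (Fin n) ℝ (EuclideanSpace ℝ (Fin n)))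
        (_hu : IsSpectralDecomposition A ev u)
        (lam δ : ℝ) (_hlam : lam = ev ⟨p - 1, by omega⟩) (_hδ : δ = lam - ev ⟨p, hpn⟩)
        (_hlam0 : lam ≠ 0) (_hgap : 2.01 * √(n : ℝ) ≤ δ)
        (E : Ω → Matrix (Fin n) (Fin n) ℝ) (_hE : IsWigner E K μ),
        μ {ω | ¬ ∀ (ev' : Fin n → ℝ) (u' : OrthonormalBasis (Fin n) ℝ (EuclideanSpace ℝ (Fin n))),
            IsSpectralDecomposition (A + E ω) ev' u' →
              ‖leadingProj u' p - leadingProj u p‖ ≤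
                C * Real.log n ^ k * (‖E ω‖ / |lam| + (r : ℝ) ^ 2 / δ)}
          ≤ ENNReal.ofReal (ε n) := by
  refine ⟨1000 * (K + 1), 1, fun n => 4 / n, tendsto_const_div_atTop_nhds_zero_nat 4, ?_⟩
  intro Ω _ μ _ n r p hp hpn A _ hr ev u hu lam δ hlam hδ hlam0 hgap E hE
  have hn0 : (0 : ℝ) < n := by exact_mod_cast (by omega : 0 < n)
  rcases lt_or_ge n 3 with hn | hn
  · refine prob_le_one.trans (ENNReal.one_le_ofReal.mpr ?_)
    have : (n : ℝ) ≤ 4 := by exact_mod_cast (by omega : n ≤ 4)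
    rwa [le_div_iff₀ hn0, one_mul]
  have hn3 : (3 : ℝ) ≤ n := by exact_mod_cast hn
  have hs : 0 < √(n : ℝ) := Real.sqrt_pos.mpr hn0
  have hκ : (1 : ℝ) ≤ K + 1 := by simp
  have hL : 1 ≤ Real.log n := by
    rw [Real.le_log_iff_exp_le hn0]
    linarith [Real.exp_one_lt_d9]
  have hκL : 1 ≤ (K + 1) * Real.log n := one_le_mul_of_one_le_of_one_le hκ hL
  set x := √(12 * (K + 1) * Real.log n) with hx
  set t := 4 * √(512 * (K + 1) * (n * Real.log n)) with ht
  have hx4 : x ≤ 4 * ((K + 1) * Real.log n) := Real.sqrt_le_iff.mpr ⟨by positivity, by nlinarith⟩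
  have ht92 : t ≤ 92 * ((K + 1) * Real.log n) * √n := by
    have : √(512 * (K + 1) * (n * Real.log n)) ≤ 23 * ((K + 1) * Real.log n) * √n := by
      refine Real.sqrt_le_iff.mpr ⟨by positivity, ?_⟩
      rw [mul_pow, Real.sq_sqrt hn0.le]
      have : 512 * ((K + 1) * Real.log n) * n ≤ (23 * ((K + 1) * Real.log n)) ^ 2 * n := by
        gcongr
        nlinarith
      linarith
    linarith
  -- Outside these two events every spectral decomposition obeys the deterministic bound.
  have hsub : {ω | ¬ ∀ (ev' : Fin n → ℝ)
      (u' : OrthonormalBasis (Fin n) ℝ (EuclideanSpace ℝ (Fin n))),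
        IsSpectralDecomposition (A + E ω) ev' u' → ‖leadingProj u' p - leadingProj u p‖ ≤
          1000 * (K + 1) * Real.log n ^ 1 * (‖E ω‖ / |lam| + (r : ℝ) ^ 2 / δ)} ⊆
      {ω | t < ‖E ω‖} ∪ {ω | ∃ i j, x ≤ |(u i).ofLp ⬝ᵥ E ω *ᵥ (u j).ofLp|} := by
    intro ω hω
    by_contra hcon
    simp only [Set.mem_union, Set.mem_ofPred_eq, not_or, not_lt, not_exists, not_le] at hcon
    refine hω fun ev' u' hu' => ?_
    rw [pow_one]
    refine le_of_deterministic_bound hκ hL hs hgap (abs_pos.mpr hlam0) (norm_nonneg _)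
      (sq_nonneg _) (hcon.1.trans ht92) hx4
      (norm_leadingProj_sub_le_two p) fun h1 h2 => ?_
    subst hr
    exact norm_leadingProj_sub_le hu hu' hp hpn hlam hδ hlam0 (by linarith)
      (fun i j => (hcon.2 i j).le) h1 h2
  refine (measure_mono hsub).trans ?_
  rw [← ofReal_measureReal]
  refine ENNReal.ofReal_le_ofReal ((measureReal_union_le _ _).trans ?_)
  have h1 := hE.measure_norm_ge_le hn
  have h2 := hE.measure_exists_basis_ge_le hn u
  calc _ ≤ 2 / (n : ℝ) + 2 / n := add_le_add h1 h2
    _ = 4 / n := by ring
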